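/- For an integer $m\ge1$ let $$Q_m(x)=e^{-x}\sum_{j=0}^{m-1}\frac{x^j}{j!},\qquad f_m(x)=e^{-x}\frac{x^{m-1}}{(m-1)!}.$$ Let $(m_n)_{n\ge1}$ be an arbitrary sequence of integers with $m_n\ge1$. For all sufficiently large $n$ the equation $nQ_{m_n}(b)=1$ has exactly one solution $b=b_n$ in $[0,\infty)$; put $a_n=Q_{m_n}(b_n)/f_{m_n}(b_n)$. (i) For each $n$ let $N_1,\dots,N_n$ be i.i.d. Poisson processes of rate one on $[0,\infty)$ and let $$\tau_n=\inf\{t\ge0: N_i(t)\ge m_n\text{ for every }i=1,\dots,n\}.$$ Then, as $n\to\infty$, $(\tau_n-b_n)/a_n$ converges in distribution to the standard Gumbel law, i.e. the law with distribution function $x\mapsto\exp(-e^{-x})$. (ii) For each $n$ let $U_1,U_2,\dots$ be i.i.d. uniform draws from $n$ coupon types and let $T_{m_n}(n)$ be the number of draws needed until each of the $n$ types has been drawn at least $m_n$ times. Then, as $n\to\infty$, $(T_{m_n}(n)-nb_n)/(na_n)$ converges in distribution to the standard Gumbel law. -/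

import Mathlib

open MeasureTheory ProbabilityTheory Filter
open scoped NNReal Topology

namespace DixieCup

noncomputable section

/-- The Erlang (integer-shape Gamma) survival function
`Q_m(x) = e^{-x} ∑_{j=0}^{m-1} x^j / j!`. -/
def erlangTail (m : ℕ) (x : ℝ) : ℝ :=
  Real.exp (-x) * ∑ j ∈ Finset.range m, x ^ j / (j.factorial : ℝ)

/-- The Erlang density `f_m(x) = e^{-x} x^{m-1} / (m-1)!` (used for `m ≥ 1`). -/
def erlangDensity (m : ℕ) (x : ℝ) : ℝ :=
  Real.exp (-x) * (x ^ (m - 1) / ((m - 1).factorial : ℝ))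

/-- The reciprocal hazard `Q_m(x) / f_m(x)`. -/
def recipHazard (m : ℕ) (x : ℝ) : ℝ :=
  erlangTail m x / erlangDensity m x

/-- The standard Gumbel distribution function `x ↦ exp(-e^{-x})`. -/
def gumbelCDF : StieltjesFunction ℝ where
  toFun x := Real.exp (-Real.exp (-x))
  mono' := fun x y h => by
    simp only [Real.exp_le_exp, neg_le_neg_iff]
    exact h
  right_continuous' := fun x => by
    have h : Continuous fun y : ℝ => Real.exp (-Real.exp (-y)) := by fun_prop
    exact h.continuousWithinAt

/-- The standard Gumbel law: the measure on `ℝ` with distribution function `exp(-e^{-x})`. -/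
def gumbelMeasure : Measure ℝ := gumbelCDF.measure

instance isProbabilityMeasure_gumbelMeasure : IsProbabilityMeasure gumbelMeasure := by
  refine StieltjesFunction.isProbabilityMeasure gumbelCDF ?_ ?_
  · change Tendsto (fun x : ℝ => Real.exp (-Real.exp (-x))) atBot (𝓝 0)
    exact Real.tendsto_exp_neg_atTop_nhds_zero.comp
      (Real.tendsto_exp_atTop.comp tendsto_neg_atBot_atTop)
  · change Tendsto (fun x : ℝ => Real.exp (-Real.exp (-x))) atTop (𝓝 1)
    have h := (Real.continuous_exp.tendsto (-0)).comp Real.tendsto_exp_neg_atTop_nhds_zero.neg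
    simpa [Function.comp_def] using h

/-- `N` is a homogeneous Poisson process of rate `r` on `[0, ∞)` under `μ`: it starts at zero, has
independent increments, the increment over `(s, t]` is Poisson with mean `r (t - s)`, and almost
every path is nondecreasing and right-continuous. -/
structure IsPoissonProcess {Ω : Type*} [MeasurableSpace Ω] (N : ℝ≥0 → Ω → ℕ) (r : ℝ≥0)
    (μ : Measure Ω) : Prop where
  measurable : ∀ t, Measurable (N t)
  zero : ∀ᵐ ω ∂μ, N 0 ω = 0
  indep : HasIndepIncrements N μ
  law : ∀ s t : ℝ≥0, s ≤ t → HasLaw (fun ω => N t ω - N s ω) (poissonMeasure (r * (t - s))) μ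
  mono : ∀ᵐ ω ∂μ, Monotone fun t => N t ω
  rightCont : ∀ᵐ ω ∂μ, ∀ t, ContinuousWithinAt (fun u => N u ω) (Set.Ici t) t

/-- The processes `N 0, …, N (n-1)` are i.i.d. Poisson processes of rate one; independence is that
of the whole paths. -/
structure IsIIDPoisson {Ω : Type*} [MeasurableSpace Ω] {n : ℕ} (N : Fin n → ℝ≥0 → Ω → ℕ)
    (μ : Measure Ω) : Prop where
  poisson : ∀ i, IsPoissonProcess (N i) 1 μ
  indep : iIndepFun (fun i ω t => N i t ω) μ

/-- The Poissonized completion time `τ = inf {t ≥ 0 : N_i(t) ≥ m for every i}`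
(the set is nonempty almost surely when the `N_i` are Poisson processes of rate one). -/
def poissonCompletionTime {Ω : Type*} {n : ℕ} (m : ℕ) (N : Fin n → ℝ≥0 → Ω → ℕ) (ω : Ω) : ℝ :=
  ((sInf {t : ℝ≥0 | ∀ i, m ≤ N i t ω} : ℝ≥0) : ℝ)

/-- The draws `U 0, U 1, …` are i.i.d. uniform on the `n` coupon types. -/
structure IsUniformDraws {Ω : Type*} [MeasurableSpace Ω] {n : ℕ} (U : ℕ → Ω → Fin n)
    (μ : Measure Ω) : Prop where
  measurable : ∀ k, Measurable (U k)
  indep : iIndepFun U μ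
  law : ∀ k, HasLaw (U k) (uniformOn Set.univ) μ

/-- The number of draws needed to collect at least `m` copies of each of the `n` coupon types:
the least `k` such that every type occurs at least `m` times among `U 0, …, U (k-1)`
(such a `k` exists almost surely for i.i.d. uniform draws). -/
def drawCompletionTime {Ω : Type*} {n : ℕ} (m : ℕ) (U : ℕ → Ω → Fin n) (ω : Ω) : ℕ :=
  sInf {k : ℕ | ∀ j : Fin n, m ≤ ((Finset.range k).filter fun i => U i ω = j).card}

end

end DixieCup

namespace DixieCup

/-! ### The Erlang survival function -/

/-! Write `m = p + 1`, `Q`, `f` for the tail and density, `a = Q(b)/f(b)`. A rate-one Poisson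
process has at least `m` points by time `t` with probability `1 - Q(t)`, so the Poissonized time has
distribution function exactly `(1 - Q(t))^n`. Part (i) thus reduces to `n Q(b + a u) → e^{-u}`, that
is `Q(b + a u)/Q(b) → e^{-u}`, with no restriction on how `p` varies with `n`.

The uniformity comes from one scale-free fact: `Q` is bounded below as long as `b - p` is at most a
constant times `√p + 1` (`exists_pos_le_erlangTail`). Since `Q(b) = 1/n → 0`, the excess satisfies
`(b - p)/(√p + 1) → ∞`. Two-sided Mills bounds then give `Q(b) ~ f(b) b/(b - p)` with relative error
of order `p/(b - p)^2 → 0`, hence `a ~ b/(b - p)`. The step `a u` changes the Mills factor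
negligibly and multiplies the density by `e^{-u}` in the limit (`tendsto_density_ratio`).

For (ii), a Poisson number of draws of mean `n t` makes the type counts independent Poisson
variables of mean `t`, so the Poisson average of `collectProb` is again `(1 - Q(t))^n`. Since
`collectProb` is monotone in the number of draws, Chebyshev's inequality undoes the averaging at
cost `n t/d^2` for a window `d`. With `d = n a e` this is of order `(b - p)^2/(b n)`, at most a
multiple of `log n / n` by the Chernoff bound at `Q(b) = 1/n`. -/

lemma erlangTail_succ (m : ℕ) (x : ℝ) :
    erlangTail (m + 1) x = erlangTail m x + erlangDensity (m + 1) x := by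
  simp only [erlangTail, erlangDensity, Finset.sum_range_succ, Nat.add_sub_cancel, mul_add]

lemma hasDerivAt_erlangDensity (p : ℕ) {x : ℝ} (hx : x ≠ 0) :
    HasDerivAt (erlangDensity (p + 1)) (erlangDensity (p + 1) x * (p / x - 1)) x := by
  have h1 : HasDerivAt (fun y : ℝ => Real.exp (-y)) (-Real.exp (-x)) x := by
    simpa using (hasDerivAt_neg x).exp
  have h2 := h1.mul ((hasDerivAt_pow p x).div_const (p.factorial : ℝ))
  refine h2.congr_deriv ?_
  simp only [erlangDensity, Nat.add_sub_cancel]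
  rcases p with _ | p
  · simp
  · have : ((p + 1).factorial : ℝ) ≠ 0 := by positivity
    simp only [Nat.add_sub_cancel]
    field_simp
    ring

lemma hasDerivAt_erlangTail (p : ℕ) (x : ℝ) :
    HasDerivAt (erlangTail (p + 1)) (-erlangDensity (p + 1) x) x := by
  have h1 : HasDerivAt (fun y : ℝ => Real.exp (-y)) (-Real.exp (-x)) x := by
    simpa using (hasDerivAt_neg x).exp
  induction p with
  | zero =>
    have : erlangTail (0 + 1) = fun y : ℝ => Real.exp (-y) := by
      funext y; simp [erlangTail]
    rw [this]
    simpa [erlangDensity] using h1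
  | succ p ih =>
    have h2 := h1.mul ((hasDerivAt_pow (p + 1) x).div_const ((p + 1).factorial : ℝ))
    have h3 : erlangTail (p + 1 + 1) = fun y => erlangTail (p + 1) y +
        Real.exp (-y) * (y ^ (p + 1) / ((p + 1).factorial : ℝ)) := by
      funext y
      rw [erlangTail_succ]
      simp [erlangDensity]
    rw [h3]
    refine (ih.add h2).congr_deriv ?_
    simp only [erlangDensity, Nat.add_sub_cancel, Nat.factorial_succ]
    push_cast
    have : (p.factorial : ℝ) ≠ 0 := by positivity
    field_simp
    ring

lemma erlangDensity_pos (p : ℕ) {x : ℝ} (hx : 0 < x) : 0 < erlangDensity (p + 1) x := by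
  unfold erlangDensity; positivity

lemma continuous_erlangTail (m : ℕ) : Continuous (erlangTail m) := by
  unfold erlangTail; fun_prop

lemma erlangTail_succ_zero (p : ℕ) : erlangTail (p + 1) 0 = 1 := by
  simp [erlangTail, Finset.sum_range_succ']

lemma erlangTail_succ_pos (p : ℕ) {x : ℝ} (hx : 0 ≤ x) : 0 < erlangTail (p + 1) x := by
  unfold erlangTail
  refine mul_pos (Real.exp_pos _) ?_
  rw [Finset.sum_range_succ']
  have : 0 ≤ ∑ k ∈ Finset.range p, x ^ (k + 1) / ((k + 1).factorial : ℝ) :=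
    Finset.sum_nonneg fun _ _ => by positivity
  simpa using by linarith

lemma strictAntiOn_erlangTail (p : ℕ) : StrictAntiOn (erlangTail (p + 1)) (Set.Ici 0) := by
  refine strictAntiOn_of_deriv_neg (convex_Ici 0) (continuous_erlangTail _).continuousOn ?_
  intro x hx
  rw [interior_Ici] at hx
  rw [(hasDerivAt_erlangTail p x).deriv]
  have := erlangDensity_pos p hx
  linarith

lemma tendsto_erlangDensity_atTop (p : ℕ) :
    Tendsto (erlangDensity (p + 1)) atTop (𝓝 0) := by
  have h := (Real.tendsto_pow_mul_exp_neg_atTop_nhds_zero p).div_const (p.factorial : ℝ)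
  rw [zero_div] at h
  refine h.congr fun x => ?_
  simp only [erlangDensity, Nat.add_sub_cancel]
  ring

lemma tendsto_erlangTail_atTop (m : ℕ) : Tendsto (erlangTail m) atTop (𝓝 0) := by
  induction m with
  | zero =>
    have : erlangTail 0 = fun _ => 0 := by funext y; simp [erlangTail]
    rw [this]
    exact tendsto_const_nhds
  | succ m ih =>
    have := ih.add (tendsto_erlangDensity_atTop m)
    rw [add_zero] at this
    exact this.congr fun x => (erlangTail_succ m x).symm

lemma existsUnique_mul_erlangTail_eq_one {r : ℝ} (hr : 1 ≤ r) {m : ℕ} (hm : 1 ≤ m) :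
    ∃! x : ℝ, 0 ≤ x ∧ r * erlangTail m x = 1 := by
  obtain ⟨p, rfl⟩ : ∃ p, m = p + 1 := ⟨m - 1, by omega⟩
  have hr0 : 0 < r := by linarith
  have hinv : r⁻¹ ≤ 1 := inv_le_one_of_one_le₀ hr
  obtain ⟨y, hy0, hy⟩ : ∃ y : ℝ, 0 ≤ y ∧ erlangTail (p + 1) y < r⁻¹ :=
    ((eventually_ge_atTop 0).and ((tendsto_erlangTail_atTop (p + 1)).eventually_lt_const
      (inv_pos.2 hr0))).exists
  obtain ⟨x, hx, hxe⟩ := intermediate_value_Icc' hy0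
    (continuous_erlangTail (p + 1)).continuousOn
    (show r⁻¹ ∈ Set.Icc (erlangTail (p + 1) y) (erlangTail (p + 1) 0) from
      ⟨hy.le, by rwa [erlangTail_succ_zero]⟩)
  refine ⟨x, ⟨hx.1, by rw [hxe]; field_simp⟩, ?_⟩
  rintro z ⟨hz0, hz⟩
  refine (strictAntiOn_erlangTail p).injOn hz0 hx.1 ?_
  rw [hxe]; field_simp; linarith

/-! ### Mills-type bounds -/

lemma tendsto_ratio_sub_atTop (p : ℝ) : Tendsto (fun x : ℝ => x / (x - p)) atTop (𝓝 1) := by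
  have h : Tendsto (fun x : ℝ => 1 + p / (x - p)) atTop (𝓝 (1 + 0)) :=
    tendsto_const_nhds.add (tendsto_const_nhds.div_atTop
      (tendsto_atTop_add_const_right _ (-p) tendsto_id))
  rw [add_zero] at h
  refine h.congr' ?_
  filter_upwards [eventually_gt_atTop p] with x hx
  have : x - p ≠ 0 := by linarith
  field_simp
  ring

/-- Since `f' = f (p/x - 1)`, the Mills approximation is an antiderivative of `-f` up to the
relative error `p/(x - p)^2`; both Mills bounds rest on this. -/
lemma hasDerivAt_density_mul_ratio (p : ℕ) {x : ℝ} (hx : (p : ℝ) < x) :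
    HasDerivAt (fun y => erlangDensity (p + 1) y * (y / (y - p)))
      (-erlangDensity (p + 1) x * (1 + p / (x - p) ^ 2)) x := by
  have h0 : x ≠ 0 := by have := p.cast_nonneg (α := ℝ); linarith
  have h1 : x - p ≠ 0 := by linarith
  have h := (hasDerivAt_erlangDensity p h0).mul
    ((hasDerivAt_id x).div ((hasDerivAt_id x).sub_const (p : ℝ)) h1)
  refine h.congr_deriv ?_
  simp only [id, Pi.div_apply]
  field_simp
  ring

/-- The difference of the two sides is monotone beyond `p` and vanishes at infinity, which fixes its
sign. -/
lemma erlangTail_le_mills (p : ℕ) {x : ℝ} (hx : (p : ℝ) < x) :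
    erlangTail (p + 1) x ≤ erlangDensity (p + 1) x * (x / (x - p)) := by
  set G : ℝ → ℝ := fun y => erlangDensity (p + 1) y * (y / (y - p)) - erlangTail (p + 1) y
  have hd : ∀ y, (p : ℝ) < y → HasDerivAt G
      (-erlangDensity (p + 1) y * (1 + p / (y - p) ^ 2) - -erlangDensity (p + 1) y) y :=
    fun y hy => (hasDerivAt_density_mul_ratio p hy).sub (hasDerivAt_erlangTail p y)
  have hanti : AntitoneOn G (Set.Ici x) := by
    refine antitoneOn_of_deriv_nonpos (convex_Ici x)
      (fun y hy => (hd y (lt_of_lt_of_le hx hy)).continuousAt.continuousWithinAt)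
      (fun y hy => ?_) (fun y hy => ?_)
    all_goals
      rw [interior_Ici] at hy
      have hy' : (p : ℝ) < y := hx.trans hy
    · exact (hd y hy').differentiableAt.differentiableWithinAt
    · rw [(hd y hy').deriv]
      have hy0 : 0 < y := lt_of_le_of_lt p.cast_nonneg hy'
      have := erlangDensity_pos p hy0
      have h2 : 0 ≤ erlangDensity (p + 1) y * (p / (y - p) ^ 2) := by positivity
      linarith
  have hlim : Tendsto G atTop (𝓝 (0 * 1 - 0)) :=
    ((tendsto_erlangDensity_atTop p).mul (tendsto_ratio_sub_atTop p)).sub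
      (tendsto_erlangTail_atTop _)
  have : 0 * 1 - 0 ≤ G x := by
    refine le_of_tendsto hlim ?_
    filter_upwards [eventually_ge_atTop x] with y hy
    exact hanti (Set.mem_Ici.2 le_rfl) hy hy
  simp only [G] at this
  linarith

lemma mills_le_erlangTail (p : ℕ) {x : ℝ} (hx : (p : ℝ) < x) :
    erlangDensity (p + 1) x * (x / (x - p)) * (1 - p / (x - p) ^ 2) ≤ erlangTail (p + 1) x := by
  set G : ℝ → ℝ := fun y =>
    erlangDensity (p + 1) y * (y / (y - p)) * (1 - p / (y - p) ^ 2) - erlangTail (p + 1) y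
  -- The correction `1 - p/(y - p)^2` overcompensates the error of the upper bound, so this
  -- derivative is nonnegative; as `G → 0` at infinity, `G ≤ 0`.
  have hd : ∀ y, (p : ℝ) < y → HasDerivAt G
      (erlangDensity (p + 1) y * ((p : ℝ) ^ 2 + 2 * p * y) / (y - p) ^ 4) y := by
    intro y hy
    have h1 : y - p ≠ 0 := by linarith
    have h2 := (((hasDerivAt_const y (p : ℝ)).div
      (((hasDerivAt_id y).sub_const (p : ℝ)).pow 2) (pow_ne_zero 2 h1)).const_sub 1)
    have h3 := ((hasDerivAt_density_mul_ratio p hy).mul h2).sub (hasDerivAt_erlangTail p y)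
    refine h3.congr_deriv ?_
    simp only [id, Pi.pow_apply, Pi.div_apply]
    field_simp
    push_cast
    ring
  have hmono : MonotoneOn G (Set.Ici x) := by
    refine monotoneOn_of_deriv_nonneg (convex_Ici x)
      (fun y hy => (hd y (lt_of_lt_of_le hx hy)).continuousAt.continuousWithinAt)
      (fun y hy => ?_) (fun y hy => ?_)
    all_goals
      rw [interior_Ici] at hy
      have hy' : (p : ℝ) < y := hx.trans hy
    · exact (hd y hy').differentiableAt.differentiableWithinAt
    · rw [(hd y hy').deriv]
      have hy0 : 0 < y := lt_of_le_of_lt p.cast_nonneg hy'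
      have := erlangDensity_pos p hy0
      positivity
  have h2 : Tendsto (fun y : ℝ => 1 - (p : ℝ) / (y - p) ^ 2) atTop (𝓝 (1 - 0)) :=
    tendsto_const_nhds.sub (tendsto_const_nhds.div_atTop
      ((tendsto_pow_atTop two_ne_zero).comp
        (tendsto_atTop_add_const_right _ (-(p : ℝ)) tendsto_id)))
  have hlim : Tendsto G atTop (𝓝 (0 * 1 * (1 - 0) - 0)) :=
    (((tendsto_erlangDensity_atTop p).mul (tendsto_ratio_sub_atTop p)).mul h2).sub
      (tendsto_erlangTail_atTop _)
  have : G x ≤ 0 * 1 * (1 - 0) - 0 := by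
    refine ge_of_tendsto hlim ?_
    filter_upwards [eventually_ge_atTop x] with y hy
    exact hmono (Set.mem_Ici.2 le_rfl) hy hy
  simp only [G] at this
  linarith

/-! ### Uniform anticoncentration and the Chernoff bound -/

/-- The Stirling sequence decreases from its first value `e/√2`, so `p! ≤ e √p (p/e)^p`. -/
lemma erlangDensity_self_ge {p : ℕ} (hp : p ≠ 0) :
    1 / (Real.exp 1 * √p) ≤ erlangDensity (p + 1) p := by
  obtain ⟨q, rfl⟩ := Nat.exists_eq_succ_of_ne_zero hp
  set p := q.succ with hpdef
  have h : Stirling.stirlingSeq p ≤ Stirling.stirlingSeq 1 :=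
    Stirling.stirlingSeq'_antitone (Nat.zero_le q)
  rw [Stirling.stirlingSeq_one, Stirling.stirlingSeq] at h
  have hp0 : (0 : ℝ) < p := by positivity
  have hs : √(2 * (p : ℝ)) = √2 * √p := Real.sqrt_mul (by norm_num) _
  have hfac : (p.factorial : ℝ) ≤ Real.exp 1 * √p * (p / Real.exp 1) ^ p := by
    rw [div_le_iff₀ (by positivity), hs] at h
    refine h.trans_eq ?_
    have : √2 ≠ 0 := by positivity
    field_simp
  have he : (p / Real.exp 1) ^ p = Real.exp (-p) * (p : ℝ) ^ p := by
    rw [div_pow, ← Real.exp_nat_mul, mul_one, Real.exp_neg]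
    field_simp
  rw [he] at hfac
  simp only [erlangDensity, Nat.add_sub_cancel]
  rw [div_le_iff₀ (by positivity)]
  have hf : (0 : ℝ) < p.factorial := by positivity
  calc (1 : ℝ) = p.factorial / p.factorial := by field_simp
    _ ≤ (Real.exp 1 * √p * (Real.exp (-p) * (p : ℝ) ^ p)) / p.factorial := by gcongr
    _ = _ := by ring

lemma erlangDensity_shift_ge {p : ℕ} (hp : p ≠ 0) {v : ℝ} (hv : 0 ≤ v) :
    erlangDensity (p + 1) p * Real.exp (-(v ^ 2 / (2 * p))) ≤ erlangDensity (p + 1) (p + v) := by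
  have hp0 : (0 : ℝ) < p := by positivity
  have hu : 0 ≤ v / p := by positivity
  -- With `u = v/p`: `log (1 + u) ≥ 2u/(u + 2)`, and `(u - u^2/2)(u + 2) = 2u - u^3/2 ≤ 2u`.
  have hlog : v / p - (v / p) ^ 2 / 2 ≤ Real.log (1 + v / p) := by
    refine le_trans ?_ (Real.le_log_one_add_of_nonneg hu)
    rw [le_div_iff₀ (by positivity)]
    have : 0 ≤ (v / p) ^ 3 := by positivity
    nlinarith
  have hpow : Real.exp (v - v ^ 2 / (2 * p)) ≤ (1 + v / p) ^ p := by
    rw [← Real.exp_log (show (0 : ℝ) < (1 + v / p) ^ p by positivity), Real.log_pow]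
    refine Real.exp_le_exp.2 (le_trans (le_of_eq ?_) (mul_le_mul_of_nonneg_left hlog hp0.le))
    field_simp
  have hsplit : ((p : ℝ) + v) ^ p = (p : ℝ) ^ p * (1 + v / p) ^ p := by
    rw [← mul_pow]; congr 1; field_simp
  simp only [erlangDensity, Nat.add_sub_cancel]
  rw [hsplit, show -((p : ℝ) + v) = -p + -v by ring, Real.exp_add]
  have : Real.exp (-(v ^ 2 / (2 * p))) = Real.exp (-v) * Real.exp (v - v ^ 2 / (2 * p)) := by
    rw [← Real.exp_add]; congr 1; ring
  rw [this]
  have h2 : 0 ≤ Real.exp (-(p : ℝ)) * ((p : ℝ) ^ p / p.factorial) * Real.exp (-v) := by positivity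
  calc _ = Real.exp (-(p : ℝ)) * ((p : ℝ) ^ p / p.factorial) * Real.exp (-v) *
        Real.exp (v - v ^ 2 / (2 * p)) := by ring
    _ ≤ Real.exp (-(p : ℝ)) * ((p : ℝ) ^ p / p.factorial) * Real.exp (-v) *
        (1 + v / p) ^ p := mul_le_mul_of_nonneg_left hpow h2
    _ = _ := by ring

/-- The tail loses at least this much over the next interval of length `√p`: there the density is at
least a constant over `√p`, and the factors `√p` cancel. -/
lemma erlangTail_ge_of_shift {p : ℕ} (hp : p ≠ 0) {K : ℝ} (hK : 0 ≤ K) :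
    Real.exp (-(1 + (K + 1) ^ 2 / 2)) ≤ erlangTail (p + 1) (p + K * √p) := by
  have hp0 : (0 : ℝ) < p := by positivity
  have hs : 0 < √(p : ℝ) := by positivity
  have hss : √(p : ℝ) ^ 2 = p := Real.sq_sqrt hp0.le
  have hlt : (p : ℝ) + K * √p < p + (K + 1) * √p := by nlinarith
  obtain ⟨ξ, hξ, hξe⟩ := exists_hasDerivAt_eq_slope (erlangTail (p + 1))
    (fun y => -erlangDensity (p + 1) y) hlt (continuous_erlangTail _).continuousOn
    (fun y _ => hasDerivAt_erlangTail p y)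
  have hξ0 : 0 ≤ ξ - p := by
    have : 0 ≤ K * √(p : ℝ) := by positivity
    linarith [hξ.1]
  have hξ1 : (ξ - p) ^ 2 / (2 * p) ≤ (K + 1) ^ 2 / 2 := by
    rw [div_le_div_iff₀ (by positivity) (by norm_num)]
    have : (ξ - p) ^ 2 ≤ ((K + 1) * √p) ^ 2 := by
      apply pow_le_pow_left₀ hξ0; linarith [hξ.2]
    rw [mul_pow, hss] at this
    nlinarith
  have hf := erlangDensity_shift_ge hp hξ0
  rw [add_sub_cancel] at hf
  have hf2 : 1 / (Real.exp 1 * √p) * Real.exp (-((K + 1) ^ 2 / 2)) ≤ erlangDensity (p + 1) ξ := by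
    refine le_trans (mul_le_mul (erlangDensity_self_ge hp)
      (Real.exp_le_exp.2 (neg_le_neg hξ1)) (Real.exp_pos _).le ?_) hf
    exact (erlangDensity_pos p hp0).le
  have hpos := erlangTail_succ_pos p (x := p + (K + 1) * √p) (by positivity)
  rw [eq_div_iff (by linarith)] at hξe
  have hdiff : (p : ℝ) + (K + 1) * √p - (p + K * √p) = √p := by ring
  rw [hdiff] at hξe
  have h3 : 1 / (Real.exp 1 * √p) * Real.exp (-((K + 1) ^ 2 / 2)) * √p ≤
      erlangDensity (p + 1) ξ * √p := mul_le_mul_of_nonneg_right hf2 hs.le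
  have h4 : 1 / (Real.exp 1 * √p) * Real.exp (-((K + 1) ^ 2 / 2)) * √p =
      Real.exp (-(1 + (K + 1) ^ 2 / 2)) := by
    rw [neg_add, Real.exp_add, Real.exp_neg 1]
    field_simp
  linarith

/-- The scale `√p + 1` also covers `p = 0`, where the tail is `e^{-x}`. For `p ≥ 1` it is at most
`2√p`, whence the `2 * L` in the constant. -/
lemma exists_pos_le_erlangTail (K : ℝ) : ∃ c > 0, ∀ (p : ℕ) (x : ℝ), 0 ≤ x →
    x ≤ p + K * (√p + 1) → c ≤ erlangTail (p + 1) x := by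
  set L := |K| with hL
  have hL0 : 0 ≤ L := abs_nonneg K
  refine ⟨min (Real.exp (-L)) (Real.exp (-(1 + (2 * L + 1) ^ 2 / 2))), by positivity, ?_⟩
  intro p x hx hxK
  have hKL : K * (√p + 1) ≤ L * (√p + 1) :=
    mul_le_mul_of_nonneg_right (le_abs_self K) (by positivity)
  rcases eq_or_ne p 0 with rfl | hp
  · refine (min_le_left _ _).trans ?_
    have : erlangTail (0 + 1) x = Real.exp (-x) := by simp [erlangTail]
    rw [this]
    simp at hxK hKL
    exact Real.exp_le_exp.2 (by linarith)
  · refine (min_le_right _ _).trans ((erlangTail_ge_of_shift hp (by positivity)).trans ?_)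
    have h1 : 1 ≤ √(p : ℝ) := Real.one_le_sqrt.2 (by exact_mod_cast Nat.one_le_iff_ne_zero.2 hp)
    have hle : x ≤ p + 2 * L * √p := by nlinarith
    exact (strictAntiOn_erlangTail p).antitoneOn hx (hx.trans hle) hle

lemma erlangTail_le_chernoff (p : ℕ) {x : ℝ} (hx : (p : ℝ) < x) :
    erlangTail (p + 1) x ≤ Real.exp (-((x - p) ^ 2 / (2 * x))) := by
  have hx0 : 0 < x := lt_of_le_of_lt p.cast_nonneg hx
  -- Exponential tilt: `l` minimizes `-l (x - p) + x l^2 / 2`, the exponent left after `e^{-l}` is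
  -- bounded by `1 - l + l^2/2`.
  set l := (x - p) / x with hl
  have hl0 : 0 ≤ l := div_nonneg (by linarith) hx0.le
  have h1 : ∑ j ∈ Finset.range (p + 1), x ^ j / (j.factorial : ℝ) ≤
      Real.exp (l * p) * ∑ j ∈ Finset.range (p + 1), (x * Real.exp (-l)) ^ j / (j.factorial : ℝ) := by
    rw [Finset.mul_sum]
    refine Finset.sum_le_sum fun j hj => ?_
    have hj' : (j : ℝ) ≤ p := by exact_mod_cast Nat.lt_succ_iff.1 (Finset.mem_range.1 hj)
    have : Real.exp (l * p) * ((x * Real.exp (-l)) ^ j / (j.factorial : ℝ)) =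
        Real.exp (l * (p - j)) * (x ^ j / (j.factorial : ℝ)) := by
      rw [mul_pow, ← Real.exp_nat_mul, mul_sub, Real.exp_sub, mul_comm l j, mul_neg, Real.exp_neg]
      ring
    rw [this]
    exact le_mul_of_one_le_left (by positivity)
      (Real.one_le_exp (mul_nonneg hl0 (by linarith)))
  have h2 := Real.sum_le_exp_of_nonneg (x := x * Real.exp (-l)) (by positivity) (p + 1)
  have h3 : Real.exp (-l) ≤ 1 - l + l ^ 2 / 2 := by
    have h4 := Real.quadratic_le_exp_of_nonneg hl0
    have h5 : 0 < 1 + l + l ^ 2 / 2 := by positivity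
    rw [Real.exp_neg]
    refine (inv_anti₀ h5 h4).trans ?_
    rw [inv_le_iff_one_le_mul₀ h5]
    -- `(1 + l + l^2/2)(1 - l + l^2/2) = 1 + l^4/4`.
    nlinarith [sq_nonneg (l ^ 2)]
  have h6 : Real.exp (-x) * ∑ j ∈ Finset.range (p + 1), x ^ j / (j.factorial : ℝ) ≤
      Real.exp (-x) * (Real.exp (l * p) * Real.exp (x * Real.exp (-l))) := by
    gcongr
    exact h1.trans (by gcongr)
  refine h6.trans ?_
  rw [← Real.exp_add, ← Real.exp_add]
  refine Real.exp_le_exp.2 ?_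
  have h7 : x * Real.exp (-l) ≤ x * (1 - l + l ^ 2 / 2) := by gcongr
  have h8 : x * l = x - p := by rw [hl]; field_simp
  have h9 : (x - p) ^ 2 / (2 * x) = x * l ^ 2 / 2 := by
    rw [hl]; field_simp
  rw [h9]
  nlinarith

/-! ### Uniform asymptotics of the Erlang tail -/

section Asymptotics

variable {ι : Type*} {l : Filter ι} {p : ι → ℕ} {b : ι → ℝ}

lemma tendsto_excess_atTop (hb : ∀ᶠ i in l, 0 ≤ b i)
    (hQ : Tendsto (fun i => erlangTail (p i + 1) (b i)) l (𝓝 0)) :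
    Tendsto (fun i => (b i - p i) / (√(p i) + 1)) l atTop := by
  refine tendsto_atTop.2 fun K => ?_
  obtain ⟨c, hc, h⟩ := exists_pos_le_erlangTail K
  filter_upwards [hb, hQ.eventually_lt_const hc] with i hi hlt
  have hpos : 0 < √(p i : ℝ) + 1 := by positivity
  rw [le_div_iff₀ hpos]
  by_contra hcon
  push Not at hcon
  linarith [h (p i) (b i) hi (by linarith)]

variable (hD : Tendsto (fun i => (b i - p i) / (√(p i) + 1)) l atTop)
include hD

lemma tendsto_sub_atTop : Tendsto (fun i => b i - p i) l atTop := by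
  refine tendsto_atTop_mono' l ?_ hD
  filter_upwards [hD.eventually_ge_atTop 0] with i hi
  have h1 : 1 ≤ √(p i : ℝ) + 1 := by linarith [Real.sqrt_nonneg (p i : ℝ)]
  have h2 : b i - p i = (b i - p i) / (√(p i) + 1) * (√(p i) + 1) := by field_simp
  rw [h2, mul_div_assoc, div_self (by positivity), mul_one]
  exact le_mul_of_one_le_right hi h1

lemma tendsto_div_sq_zero : Tendsto (fun i => (p i : ℝ) / (b i - p i) ^ 2) l (𝓝 0) := by
  have h : Tendsto (fun i => (((b i - p i) / (√(p i) + 1)) ^ 2)⁻¹) l (𝓝 0) :=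
    tendsto_inv_atTop_zero.comp ((tendsto_pow_atTop two_ne_zero).comp hD)
  refine squeeze_zero (fun i => by positivity) (fun i => ?_) h
  rw [div_pow, inv_div]
  refine div_le_div_of_nonneg_right ?_ (sq_nonneg _)
  nlinarith [Real.sq_sqrt (Nat.cast_nonneg (α := ℝ) (p i)), Real.sqrt_nonneg (p i : ℝ)]

/-- Split `b = (b - p) + p`. -/
lemma tendsto_base_div_sq_zero : Tendsto (fun i => b i / (b i - p i) ^ 2) l (𝓝 0) := by
  have h := (tendsto_inv_atTop_zero.comp (tendsto_sub_atTop hD)).add (tendsto_div_sq_zero hD)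
  rw [add_zero] at h
  refine h.congr' ?_
  filter_upwards [(tendsto_sub_atTop hD).eventually_gt_atTop 0] with i hi
  simp only [Function.comp]
  field_simp
  ring

lemma tendsto_mills : Tendsto (fun i => erlangTail (p i + 1) (b i) /
    (erlangDensity (p i + 1) (b i) * (b i / (b i - p i)))) l (𝓝 1) := by
  have h := (tendsto_div_sq_zero hD).const_sub 1
  rw [sub_zero] at h
  refine tendsto_of_tendsto_of_tendsto_of_le_of_le' h tendsto_const_nhds ?_ ?_
  all_goals
    filter_upwards [(tendsto_sub_atTop hD).eventually_gt_atTop 0] with i hi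
    have hlt : (p i : ℝ) < b i := by linarith
    have hb0 : 0 < b i := lt_of_le_of_lt (p i).cast_nonneg hlt
    have hpos : 0 < erlangDensity (p i + 1) (b i) * (b i / (b i - p i)) :=
      mul_pos (erlangDensity_pos _ hb0) (by positivity)
  · rw [le_div_iff₀ hpos, mul_comm]
    exact mills_le_erlangTail _ hlt
  · rw [div_le_one hpos]
    exact erlangTail_le_mills _ hlt

lemma tendsto_recipHazard_mul :
    Tendsto (fun i => recipHazard (p i + 1) (b i) * ((b i - p i) / b i)) l (𝓝 1) := by
  refine (tendsto_mills hD).congr' ?_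
  filter_upwards [(tendsto_sub_atTop hD).eventually_gt_atTop 0] with i hi
  have hb0 : 0 < b i := lt_of_le_of_lt (p i).cast_nonneg (by linarith : (p i : ℝ) < b i)
  have := (erlangDensity_pos (p i) hb0).ne'
  simp only [recipHazard]
  field_simp

lemma eventually_recipHazard_pos : ∀ᶠ i in l, 0 < recipHazard (p i + 1) (b i) := by
  filter_upwards [(tendsto_sub_atTop hD).eventually_gt_atTop 0] with i hi
  have hb0 : 0 < b i := lt_of_le_of_lt (p i).cast_nonneg (by linarith : (p i : ℝ) < b i)
  exact div_pos (erlangTail_succ_pos _ hb0.le) (erlangDensity_pos _ hb0)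

/-- The relative step `a u / b` multiplied by the excess `b - p` tends to `u`. -/
lemma tendsto_excess_mul_step (u : ℝ) :
    Tendsto (fun i => (b i - p i) * (recipHazard (p i + 1) (b i) * u / b i)) l (𝓝 u) := by
  have h := (tendsto_recipHazard_mul hD).mul_const u
  rw [one_mul] at h
  exact h.congr fun i => by ring

lemma tendsto_step_zero (u : ℝ) :
    Tendsto (fun i => recipHazard (p i + 1) (b i) * u / b i) l (𝓝 0) := by
  refine ((tendsto_excess_mul_step hD u).div_atTop (tendsto_sub_atTop hD)).congr' ?_
  filter_upwards [(tendsto_sub_atTop hD).eventually_gt_atTop 0] with i hi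
  field_simp

lemma tendsto_shift_div (u : ℝ) :
    Tendsto (fun i => (b i + recipHazard (p i + 1) (b i) * u) / b i) l (𝓝 1) := by
  have h := (tendsto_step_zero hD u).const_add 1
  rw [add_zero] at h
  refine h.congr' ?_
  filter_upwards [(tendsto_sub_atTop hD).eventually_gt_atTop 0] with i hi
  have hb0 : 0 < b i := lt_of_le_of_lt (p i).cast_nonneg (by linarith : (p i : ℝ) < b i)
  field_simp

lemma tendsto_shift_excess_div (u : ℝ) :
    Tendsto (fun i => (b i + recipHazard (p i + 1) (b i) * u - p i) / (b i - p i)) l (𝓝 1) := by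
  have h := ((tendsto_excess_mul_step hD u).mul (tendsto_base_div_sq_zero hD)).const_add 1
  rw [mul_zero, add_zero] at h
  refine h.congr' ?_
  filter_upwards [(tendsto_sub_atTop hD).eventually_gt_atTop 0] with i hi
  have hb0 : 0 < b i := lt_of_le_of_lt (p i).cast_nonneg (by linarith : (p i : ℝ) < b i)
  field_simp
  ring

lemma tendsto_shift_excess_atTop (u : ℝ) :
    Tendsto (fun i => (b i + recipHazard (p i + 1) (b i) * u - p i) / (√(p i) + 1)) l atTop := by
  refine ((tendsto_shift_excess_div hD u).pos_mul_atTop one_pos hD).congr' ?_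
  filter_upwards [(tendsto_sub_atTop hD).eventually_gt_atTop 0] with i hi
  field_simp

lemma tendsto_density_ratio (u : ℝ) :
    Tendsto (fun i => erlangDensity (p i + 1) (b i + recipHazard (p i + 1) (b i) * u) /
      erlangDensity (p i + 1) (b i)) l (𝓝 (Real.exp (-u))) := by
  -- The density ratio is `exp (-(b w) + p log (1 + w))`. Its linear part `-(b - p) w` tends to
  -- `-u`, and the quadratic error is controlled by `p w^2 = p/(b - p)^2 * ((b - p) w)^2 → 0`.
  set w : ι → ℝ := fun i => recipHazard (p i + 1) (b i) * u / b i with hw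
  have hDw : Tendsto (fun i => (b i - p i) * w i) l (𝓝 u) := tendsto_excess_mul_step hD u
  have hw0 : Tendsto w l (𝓝 0) := tendsto_step_zero hD u
  have hpw : Tendsto (fun i => 2 * ((p i : ℝ) * w i ^ 2)) l (𝓝 0) := by
    have h := ((tendsto_div_sq_zero hD).mul (hDw.pow 2)).const_mul 2
    rw [zero_mul, mul_zero] at h
    refine h.congr' ?_
    filter_upwards [(tendsto_sub_atTop hD).eventually_gt_atTop 0] with i hi
    field_simp
  have hlow := hDw.neg.sub hpw
  rw [sub_zero] at hlow
  have hE : Tendsto (fun i => -(b i * w i) + p i * Real.log (1 + w i)) l (𝓝 (-u)) := by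
    refine tendsto_of_tendsto_of_tendsto_of_le_of_le' hlow hDw.neg ?_ ?_
    all_goals
      filter_upwards [hw0.eventually_const_lt (show (-(1 / 2) : ℝ) < 0 by norm_num)] with i hi
      have h1 : 0 < 1 + w i := by linarith
      have hp0 : (0 : ℝ) ≤ p i := (p i).cast_nonneg
    · have h2 : w i - 2 * w i ^ 2 ≤ Real.log (1 + w i) := by
        refine le_trans ?_ (Real.one_sub_inv_le_log_of_pos h1)
        have h3 : 1 - (1 + w i)⁻¹ - (w i - 2 * w i ^ 2) = w i ^ 2 * (1 + 2 * w i) / (1 + w i) := by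
          field_simp; ring
        have h4 : 0 ≤ w i ^ 2 * (1 + 2 * w i) / (1 + w i) :=
          div_nonneg (mul_nonneg (sq_nonneg _) (by linarith)) h1.le
        linarith
      nlinarith [mul_le_mul_of_nonneg_left h2 hp0]
    · have h2 : Real.log (1 + w i) ≤ w i := by linarith [Real.log_le_sub_one_of_pos h1]
      nlinarith [mul_le_mul_of_nonneg_left h2 hp0]
  refine ((Real.continuous_exp.tendsto _).comp hE).congr' ?_
  filter_upwards [(tendsto_sub_atTop hD).eventually_gt_atTop 0,
    hw0.eventually_const_lt (show (-1 : ℝ) < 0 by norm_num)] with i hi hi2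
  have hb0 : 0 < b i := lt_of_le_of_lt (p i).cast_nonneg (by linarith : (p i : ℝ) < b i)
  have h1 : 0 < 1 + w i := by linarith
  have hy : b i + recipHazard (p i + 1) (b i) * u = b i * (1 + w i) := by
    simp only [hw]; field_simp
  rw [hy]
  simp only [Function.comp, erlangDensity, Nat.add_sub_cancel]
  rw [Real.exp_add, ← Real.log_pow, Real.exp_log (by positivity), mul_pow,
    show -(b i * (1 + w i)) = -(b i) + -(b i * w i) by ring, Real.exp_add]
  field_simp

lemma tendsto_erlangTail_ratio (u : ℝ) :
    Tendsto (fun i => erlangTail (p i + 1) (b i + recipHazard (p i + 1) (b i) * u) /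
      erlangTail (p i + 1) (b i)) l (𝓝 (Real.exp (-u))) := by
  have hD' := tendsto_shift_excess_atTop hD u
  -- Mills at the shifted point and at `b`: the tail ratio becomes the density ratio times factors
  -- tending to `1`.
  have h := (((tendsto_mills hD').mul (tendsto_density_ratio hD u)).mul
    ((tendsto_shift_div hD u).div (tendsto_shift_excess_div hD u) one_ne_zero)).div
    (tendsto_mills hD) one_ne_zero
  simp only [one_mul, mul_one, div_one] at h
  refine h.congr' ?_
  filter_upwards [(tendsto_sub_atTop hD).eventually_gt_atTop 0,
    (tendsto_sub_atTop hD').eventually_gt_atTop 0] with i hi hi'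
  have hb0 : 0 < b i := lt_of_le_of_lt (p i).cast_nonneg (by linarith : (p i : ℝ) < b i)
  simp only [Pi.div_apply]
  generalize b i + recipHazard (p i + 1) (b i) * u = y at *
  have hy0 : 0 < y := lt_of_le_of_lt (p i).cast_nonneg (by linarith : (p i : ℝ) < y)
  have h1 := (erlangDensity_pos (p i) hb0).ne'
  have h2 := (erlangDensity_pos (p i) hy0).ne'
  have h3 := (erlangTail_succ_pos (p i) hb0.le).ne'
  field_simp

lemma eventually_shift_pos (u : ℝ) :
    ∀ᶠ i in l, 0 < b i + recipHazard (p i + 1) (b i) * u := by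
  filter_upwards [(tendsto_sub_atTop (tendsto_shift_excess_atTop hD u)).eventually_gt_atTop 0]
    with i hi
  exact lt_of_le_of_lt (p i).cast_nonneg
    (by linarith : (p i : ℝ) < b i + recipHazard (p i + 1) (b i) * u)

end Asymptotics

/-! ### Limits along the centering sequence -/

section Coupons

variable {b : ℕ+ → ℝ}

lemma tendsto_pnat_cast : Tendsto (fun n : ℕ+ => ((n : ℕ) : ℝ)) atTop atTop :=
  tendsto_natCast_atTop_atTop.comp tendsto_PNat_val_atTop_atTop

/-- `b` eventually solves the centering equation `n Q_{m_n}(b_n) = 1`, with `m n = p n + 1`. -/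
def IsCentering (p : ℕ+ → ℕ) (b : ℕ+ → ℝ) : Prop :=
  ∀ᶠ n : ℕ+ in atTop, 0 ≤ b n ∧ (n : ℝ) * erlangTail (p n + 1) (b n) = 1

variable {p : ℕ+ → ℕ}

lemma IsCentering.tendsto_excess (h : IsCentering p b) :
    Tendsto (fun n => (b n - p n) / (√(p n) + 1)) atTop atTop := by
  refine tendsto_excess_atTop (h.mono fun n hn => hn.1) ?_
  refine (tendsto_inv_atTop_zero.comp tendsto_pnat_cast).congr' ?_
  filter_upwards [h] with n hn
  exact (eq_inv_of_mul_eq_one_right hn.2).symm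

lemma IsCentering.tendsto_mul_erlangTail (h : IsCentering p b) (u : ℝ) :
    Tendsto (fun n : ℕ+ => (n : ℝ) * erlangTail (p n + 1)
      (b n + recipHazard (p n + 1) (b n) * u)) atTop (𝓝 (Real.exp (-u))) := by
  refine (tendsto_erlangTail_ratio h.tendsto_excess u).congr' ?_
  filter_upwards [h] with n hn
  have hpos := erlangTail_succ_pos (p n) hn.1
  rw [div_eq_iff hpos.ne']
  linear_combination (-erlangTail (p n + 1) (b n + recipHazard (p n + 1) (b n) * u)) * hn.2

lemma tendsto_one_sub_pow {q : ℕ+ → ℝ} {s : ℝ}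
    (hq : Tendsto (fun n : ℕ+ => (n : ℝ) * q n) atTop (𝓝 s)) :
    Tendsto (fun n : ℕ+ => (1 - q n) ^ (n : ℕ)) atTop (𝓝 (Real.exp (-s))) := by
  -- Extension to all of `ℕ`, where the compound-interest limit is stated; the value at `0` is
  -- irrelevant.
  set g : ℕ → ℝ := fun n => if hn : 0 < n then -q ⟨n, hn⟩ else 0
  have hg : Tendsto (fun n : ℕ => (n : ℝ) * g n) atTop (𝓝 (-s)) := by
    rw [← PNat.tendsto_comp_val_iff]
    refine hq.neg.congr fun n => ?_
    have : g n = -q n := dif_pos n.pos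
    rw [this, mul_neg]
  refine ((Real.tendsto_one_add_pow_exp_of_tendsto hg).comp tendsto_PNat_val_atTop_atTop).congr
    fun n => ?_
  have : g n = -q n := dif_pos n.pos
  simp only [Function.comp, sub_eq_add_neg]
  rw [← this]

lemma IsCentering.tendsto_one_sub_erlangTail_pow (h : IsCentering p b) (u : ℝ) :
    Tendsto (fun n : ℕ+ => (1 - erlangTail (p n + 1)
      (b n + recipHazard (p n + 1) (b n) * u)) ^ (n : ℕ)) atTop
      (𝓝 (Real.exp (-Real.exp (-u)))) :=
  tendsto_one_sub_pow (h.tendsto_mul_erlangTail u)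

/-- The fluctuations of a Poisson variable of mean `n b` are negligible at the scale `n a`. -/
lemma IsCentering.tendsto_variance_ratio (h : IsCentering p b) (u : ℝ) :
    Tendsto (fun n : ℕ+ => (b n + recipHazard (p n + 1) (b n) * u) /
      (n * recipHazard (p n + 1) (b n) ^ 2)) atTop (𝓝 0) := by
  have hD := h.tendsto_excess
  have hlog : Tendsto (fun n : ℕ+ => 2 * (Real.log n / n)) atTop (𝓝 0) := by
    have := (Real.isLittleO_log_id_atTop.tendsto_div_nhds_zero.comp tendsto_pnat_cast).const_mul 2
    rw [mul_zero] at this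
    exact this
  -- Chernoff at `Q(b) = 1/n` gives `(b - p)^2/(2b) ≤ log n`.
  have hDb : Tendsto (fun n : ℕ+ => (b n - p n) ^ 2 / b n / n) atTop (𝓝 0) := by
    refine squeeze_zero' ?_ ?_ hlog
    · filter_upwards [h] with n hn
      have := hn.1
      positivity
    · filter_upwards [h, (tendsto_sub_atTop hD).eventually_gt_atTop 0] with n hn hpos
      have hlt : (p n : ℝ) < b n := by linarith
      have hb0 : 0 < b n := lt_of_le_of_lt (p n).cast_nonneg hlt
      have hn0 : (0 : ℝ) < n := by exact_mod_cast n.pos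
      have h1 := mul_le_mul_of_nonneg_left (erlangTail_le_chernoff (p n) hlt) hn0.le
      rw [hn.2, Real.exp_neg, ← div_eq_mul_inv, one_le_div (Real.exp_pos _)] at h1
      have h2 := (Real.le_log_iff_exp_le hn0).2 h1
      rw [← mul_div_assoc]
      refine div_le_div_of_nonneg_right ?_ hn0.le
      calc (b n - p n) ^ 2 / b n = 2 * ((b n - p n) ^ 2 / (2 * b n)) := by field_simp
        _ ≤ 2 * Real.log n := by linarith
  have hκ := (tendsto_recipHazard_mul hD).pow 2
  -- With `κ = a (b - p)/b → 1`, the ratio in question is `(b - p)^2/(b n) / κ^2 * (b + a u)/b`.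
  have hmain := (hDb.div hκ (by norm_num)).mul (tendsto_shift_div hD u)
  rw [one_pow, zero_div, zero_mul] at hmain
  refine hmain.congr' ?_
  filter_upwards [(tendsto_sub_atTop hD).eventually_gt_atTop 0,
    eventually_recipHazard_pos hD] with n hpos ha
  have hlt : (p n : ℝ) < b n := by linarith
  have hb0 : 0 < b n := lt_of_le_of_lt (p n).cast_nonneg hlt
  have hn0 : (0 : ℝ) < n := by exact_mod_cast n.pos
  simp only [Pi.div_apply]
  field_simp

end Coupons

/-! ### Counting words by letter frequencies -/

/-- The number of words with prescribed letter frequencies is a multinomial coefficient. -/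
lemma card_words_eq_multinomial {α : Type*} [Fintype α] [DecidableEq α] {k : ℕ} {c : α → ℕ}
    (hc : ∑ j, c j = k) :
    (Finset.univ.filter fun w : Fin k → α =>
      (fun j => (Finset.univ.filter fun i => w i = j).card) = c).card =
      Nat.multinomial Finset.univ c := by
  -- Expand `(∑ X_j)^k` once over words and once by the multinomial theorem, then compare
  -- coefficients of `X^c`.
  have h := (Fintype.sum_pow (fun j : α => (MvPolynomial.X j : MvPolynomial α ℕ)) k).symm.trans
    (Finset.sum_pow_eq_sum_piAntidiag Finset.univ _ k)
  have hmon : ∀ d : α → ℕ, ∏ j, (MvPolynomial.X j : MvPolynomial α ℕ) ^ d j =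
      MvPolynomial.monomial (Finsupp.equivFunOnFinite.symm d) 1 := by
    intro d
    rw [MvPolynomial.monomial_eq, Finsupp.prod_fintype _ _ (by simp)]
    simp
  have hw : ∀ w : Fin k → α, ∏ i, (MvPolynomial.X (w i) : MvPolynomial α ℕ) =
      MvPolynomial.monomial (Finsupp.equivFunOnFinite.symm
        fun j => (Finset.univ.filter fun i => w i = j).card) 1 := by
    intro w
    rw [← hmon, ← Finset.prod_fiberwise' Finset.univ w]
    simp
  simp only [hmon, hw] at h
  have h2 := congrArg (MvPolynomial.coeff (Finsupp.equivFunOnFinite.symm c)) h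
  simp only [MvPolynomial.coeff_sum, MvPolynomial.coeff_monomial, ← map_natCast MvPolynomial.C,
    MvPolynomial.coeff_C_mul, EmbeddingLike.apply_eq_iff_eq] at h2
  rw [Finset.card_filter, h2, Finset.sum_eq_single c]
  · simp
  · intro d _ hd
    simp [hd]
  · intro hnot
    exact absurd (by simpa [Finset.mem_piAntidiag] using hc) hnot

/-- The probability that `k` uniform draws from `n` types contain every type at least `m` times. -/
noncomputable def collectProb (n m k : ℕ) : ℝ :=
  ((Finset.univ.filter fun w : Fin k → Fin n =>
    ∀ j, m ≤ (Finset.univ.filter fun i => w i = j).card).card : ℝ) / (n : ℝ) ^ k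

lemma card_good_words (n m k : ℕ) :
    (Finset.univ.filter fun w : Fin k → Fin n =>
      ∀ j, m ≤ (Finset.univ.filter fun i => w i = j).card).card =
    ∑ c ∈ (Finset.piAntidiag Finset.univ k).filter (fun c : Fin n → ℕ => ∀ j, m ≤ c j),
      Nat.multinomial Finset.univ c := by
  rw [Finset.card_eq_sum_card_fiberwise
    (f := fun (w : Fin k → Fin n) j => (Finset.univ.filter fun i => w i = j).card)
    (t := (Finset.piAntidiag Finset.univ k).filter (fun c : Fin n → ℕ => ∀ j, m ≤ c j))]
  · refine Finset.sum_congr rfl fun c hc => ?_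
    simp only [Finset.mem_filter, Finset.mem_piAntidiag] at hc
    rw [← card_words_eq_multinomial hc.1.1, Finset.filter_filter]
    congr 1
    ext w
    simp only [Finset.mem_filter, Finset.mem_univ, true_and, and_iff_right_iff_imp]
    rintro rfl
    exact hc.2
  · intro w hw
    simp only [Finset.coe_filter, Finset.mem_univ, true_and, Set.mem_ofPred_eq,
      Finset.mem_piAntidiag, implies_true, and_true] at hw ⊢
    refine ⟨?_, hw⟩
    rw [← Finset.card_eq_sum_card_fiberwise (fun _ _ => Finset.mem_coe.2 (Finset.mem_univ _))]
    simp

/-! ### Poisson tails and Poissonization -/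

lemma poissonMeasure_real_Iio (t : ℝ≥0) (m : ℕ) :
    (poissonMeasure t).real (Set.Iio m) = erlangTail m t := by
  have : Set.Iio m = ((Finset.range m : Finset ℕ) : Set ℕ) := by ext; simp
  rw [this, ← sum_measureReal_singleton]
  simp only [poissonMeasure_real_singleton, erlangTail, Finset.mul_sum, mul_div_assoc]

lemma poissonMeasure_real_Ici (t : ℝ≥0) (m : ℕ) :
    (poissonMeasure t).real (Set.Ici m) = 1 - erlangTail m t := by
  rw [← poissonMeasure_real_Iio, ← Set.compl_Iio, probReal_compl_eq_one_sub measurableSet_Iio]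

/-- Poissonization: a Poisson number of mean `n t` of uniform draws completes the collection with
probability `(1 - Q_m(t))^n`. -/
lemma hasSum_poisson_mul_collectProb {n : ℕ} (hn : n ≠ 0) (m : ℕ) (t : ℝ≥0) :
    HasSum (fun k : ℕ => Real.exp (-(n * t)) * (n * t) ^ k / k.factorial * collectProb n m k)
      ((1 - erlangTail m t) ^ n) := by
  set μ : Measure (Fin n → ℕ) := Measure.pi fun _ => poissonMeasure t
  set A : Set (Fin n → ℕ) := {c | ∀ j, m ≤ c j}
  have hA : μ.real A = (1 - erlangTail m t) ^ n := by
    have : A = Set.univ.pi fun _ => Set.Ici m := by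
      ext; simp only [A, Set.mem_ofPred_eq, Set.mem_univ_pi, Set.mem_Ici]
    rw [this, measureReal_def, Measure.pi_pi, ENNReal.toReal_prod]
    simp only [← measureReal_def, poissonMeasure_real_Ici]
    simp
  have hsing : ∀ c : Fin n → ℕ, μ.real {c} =
      ∏ j, (Real.exp (-t) * t ^ c j / (c j).factorial) := by
    intro c
    rw [measureReal_def, Measure.pi_singleton, ENNReal.toReal_prod]
    simp only [← measureReal_def, poissonMeasure_real_singleton]
  -- A count vector `c` of total `k` has product weight `e^{-nt} t^k / ∏ c_j!`, which is the Poisson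
  -- weight of `k` times the multinomial coefficient over `n^k`.
  have hk : ∀ k : ℕ, μ.real (A ∩ {c | ∑ j, c j = k}) =
      Real.exp (-(n * t)) * (n * t) ^ k / k.factorial * collectProb n m k := by
    intro k
    have hset : A ∩ {c | ∑ j, c j = k} = (((Finset.piAntidiag Finset.univ k).filter
        (fun c : Fin n → ℕ => ∀ j, m ≤ c j) : Finset (Fin n → ℕ)) : Set (Fin n → ℕ)) := by
      ext c
      simp [A, and_comm]
    rw [hset, ← sum_measureReal_singleton, collectProb, card_good_words]
    push_cast
    rw [Finset.sum_div, Finset.mul_sum]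
    refine Finset.sum_congr rfl fun c hc => ?_
    simp only [Finset.mem_filter, Finset.mem_piAntidiag] at hc
    have hspec := Nat.multinomial_spec Finset.univ c
    rw [hc.1.1] at hspec
    have hspec' : (∏ j, ((c j).factorial : ℝ)) * Nat.multinomial Finset.univ c = k.factorial := by
      exact_mod_cast hspec
    have hpos : (∏ j, ((c j).factorial : ℝ)) ≠ 0 :=
      Finset.prod_ne_zero_iff.2 fun j _ => by positivity
    have hkf : (k.factorial : ℝ) ≠ 0 := by positivity
    have hn' : (n : ℝ) ≠ 0 := by exact_mod_cast hn
    rw [hsing, Finset.prod_div_distrib, Finset.prod_mul_distrib, Finset.prod_const,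
      Finset.prod_pow_eq_pow_sum, hc.1.1, ← Real.exp_nat_mul, mul_pow]
    simp only [Finset.card_univ, Fintype.card_fin, mul_neg]
    field_simp
    rw [← hspec']
    ring
  have hU : A = ⋃ k : ℕ, A ∩ {c | ∑ j, c j = k} := by
    ext c; simp
  have hdisj : Pairwise (Function.onFun Disjoint fun k : ℕ => A ∩ {c : Fin n → ℕ | ∑ j, c j = k}) := by
    intro k k' hkk
    refine Set.disjoint_left.2 fun c hc hc' => hkk ?_
    exact hc.2.symm.trans hc'.2
  have hsum := measure_iUnion (μ := μ) hdisj (fun k => (Set.to_countable _).measurableSet)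
  rw [← hU] at hsum
  have hne : ∑' k : ℕ, μ (A ∩ {c | ∑ j, c j = k}) ≠ ⊤ := by
    rw [← hsum]; exact measure_ne_top _ _
  have hs := ENNReal.hasSum_toReal hne
  rw [← ENNReal.tsum_toReal_eq (fun k => measure_ne_top _ _), ← hsum, ← measureReal_def, hA] at hs
  simpa only [← measureReal_def, hk] using hs

lemma hasSum_poisson_variance (r : ℝ) :
    HasSum (fun k : ℕ => Real.exp (-r) * r ^ k / k.factorial * ((k : ℝ) - r) ^ 2) r := by
  have h0 : HasSum (fun k : ℕ => Real.exp (-r) * r ^ k / k.factorial) 1 := by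
    have h := (NormedSpace.expSeries_div_hasSum_exp (𝔸 := ℝ) r).mul_left (Real.exp (-r))
    rw [← Real.exp_eq_exp_ℝ, ← Real.exp_add, neg_add_cancel, Real.exp_zero] at h
    simpa only [mul_div_assoc] using h
  have h1 : HasSum (fun k : ℕ => Real.exp (-r) * r ^ k / k.factorial * k) r := by
    rw [← hasSum_nat_add_iff' 1]
    simp only [Finset.sum_range_one, Nat.cast_zero, mul_zero, sub_zero]
    have h := h0.mul_left r
    rw [mul_one] at h
    refine h.congr_fun fun k => ?_
    rw [Nat.factorial_succ]
    push_cast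
    have : (k.factorial : ℝ) ≠ 0 := by positivity
    field_simp
    ring
  have h2 : HasSum (fun k : ℕ => Real.exp (-r) * r ^ k / k.factorial * (k * (k - 1))) (r * r) := by
    rw [← hasSum_nat_add_iff' 1]
    simp only [Finset.sum_range_one, Nat.cast_zero, zero_mul, mul_zero, sub_zero]
    refine (h1.mul_left r).congr_fun fun k => ?_
    rw [Nat.factorial_succ]
    push_cast
    have : (k.factorial : ℝ) ≠ 0 := by positivity
    field_simp
    ring
  -- `(k - r)^2 = k (k - 1) + (1 - 2r) k + r^2`.
  have h := (h2.add (h1.mul_left (1 - 2 * r))).add (h0.mul_left (r ^ 2))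
  have he : r * r + (1 - 2 * r) * r + r ^ 2 * 1 = r := by ring
  rw [he] at h
  exact h.congr_fun fun k => by ring

/-! ### Chebyshev comparison of a Poisson average with a single value -/

section Depoissonization

variable {F : ℕ → ℝ} {r S : ℝ} (hF : Monotone F) (h0 : ∀ k, 0 ≤ F k) (h1 : ∀ k, F k ≤ 1)
  (hr : 0 ≤ r) (hS : HasSum (fun k : ℕ => Real.exp (-r) * r ^ k / k.factorial * F k) S)
include hF h0 h1 hr hS

/-- Termwise, `F k ≤ F k₀ + ((k - r)/d)^2`: monotonicity for `k ≤ k₀`, and otherwise the square is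
at least `1`. Only `k ≥ k₀ + 1` needs the square, so `k₀` can later be a floor. -/
lemma poisson_average_le {k₀ : ℕ} {d : ℝ} (hd : 0 < d) (hk : r + d ≤ k₀ + 1) :
    S ≤ F k₀ + r / d ^ 2 := by
  have hone : HasSum (fun k : ℕ => Real.exp (-r) * r ^ k / k.factorial) 1 :=
    hasSum_one_poissonMeasure ⟨r, hr⟩
  have hb := (hone.mul_right (F k₀)).add ((hasSum_poisson_variance r).div_const (d ^ 2))
  rw [one_mul] at hb
  refine hasSum_le (fun k => ?_) hS hb
  have hp : 0 ≤ Real.exp (-r) * r ^ k / k.factorial := by positivity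
  rw [mul_div_assoc _ (((k : ℝ) - r) ^ 2) (d ^ 2), ← mul_add]
  refine mul_le_mul_of_nonneg_left ?_ hp
  rcases le_or_gt k k₀ with hle | hlt
  · have : 0 ≤ ((k : ℝ) - r) ^ 2 / d ^ 2 := by positivity
    linarith [hF hle]
  · have hlt' : (k₀ : ℝ) + 1 ≤ k := by exact_mod_cast hlt
    have : 1 ≤ ((k : ℝ) - r) ^ 2 / d ^ 2 := by
      rw [one_le_div (by positivity)]
      exact pow_le_pow_left₀ hd.le (by linarith) 2
    linarith [h1 k, h0 k₀]

lemma le_poisson_average {k₀ : ℕ} {d : ℝ} (hd : 0 < d) (hk : k₀ ≤ r - d) :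
    F k₀ ≤ S + r / d ^ 2 := by
  have hone : HasSum (fun k : ℕ => Real.exp (-r) * r ^ k / k.factorial) 1 :=
    hasSum_one_poissonMeasure ⟨r, hr⟩
  have hb := hS.add ((hasSum_poisson_variance r).div_const (d ^ 2))
  have ha := hone.mul_right (F k₀)
  rw [one_mul] at ha
  refine hasSum_le (fun k => ?_) ha hb
  have hp : 0 ≤ Real.exp (-r) * r ^ k / k.factorial := by positivity
  rw [mul_div_assoc _ (((k : ℝ) - r) ^ 2) (d ^ 2), ← mul_add]
  refine mul_le_mul_of_nonneg_left ?_ hp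
  rcases le_or_gt k₀ k with hle | hlt
  · have : 0 ≤ ((k : ℝ) - r) ^ 2 / d ^ 2 := by positivity
    linarith [hF hle]
  · have hlt' : (k : ℝ) ≤ k₀ := by exact_mod_cast hlt.le
    have : 1 ≤ ((k : ℝ) - r) ^ 2 / d ^ 2 := by
      rw [one_le_div (by positivity), ← neg_sq ((k : ℝ) - r)]
      exact pow_le_pow_left₀ hd.le (by linarith) 2
    linarith [h1 k₀, h0 k]

end Depoissonization

/-! ### Convergence in distribution from distribution functions -/

lemma tendstoInDistribution_of_tendsto_cdf {ι : Type*} {l : Filter ι} [l.IsCountablyGenerated]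
    {Ω : ι → Type*} [∀ i, MeasurableSpace (Ω i)] {μ : ∀ i, Measure (Ω i)}
    [∀ i, IsProbabilityMeasure (μ i)] {ν : Measure ℝ} [IsProbabilityMeasure ν]
    {X : ∀ i, Ω i → ℝ} (hX : ∀ i, AEMeasurable (X i) (μ i))
    (h : ∀ u, Tendsto (fun i => (μ i).real {ω | X i ω ≤ u}) l (𝓝 (ν.real (Set.Iic u)))) :
    TendstoInDistribution X l (id : ℝ → ℝ) μ ν := by
  refine ⟨hX, aemeasurable_id, ?_⟩
  -- Half-open intervals form a π-system containing arbitrarily small neighbourhoods of each point,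
  -- and their masses are differences of distribution functions.
  refine IsPiSystem.tendsto_probabilityMeasure_of_tendsto_of_mem
    (S := {s | ∃ a b : ℝ, a < b ∧ Set.Ioc a b = s}) ?_ ?_ ?_ ?_
  · exact isPiSystem_Ioc id id
  · rintro s ⟨a, b, -, rfl⟩
    exact measurableSet_Ioc
  · intro u hu x hx
    obtain ⟨e, he, hsub⟩ := Metric.isOpen_iff.1 hu x hx
    refine ⟨_, ⟨x - e / 2, x + e / 2, by linarith, rfl⟩, Ioc_mem_nhds (by linarith) (by linarith),
      fun y hy => hsub ?_⟩
    rw [Metric.mem_ball, Real.dist_eq, abs_lt]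
    constructor <;> linarith [hy.1, hy.2]
  · rintro s ⟨a, b, hab, rfl⟩
    have hIoc : ∀ ρ : Measure ℝ, IsProbabilityMeasure ρ →
        ρ.real (Set.Ioc a b) = ρ.real (Set.Iic b) - ρ.real (Set.Iic a) := by
      intro ρ _
      rw [← Set.Iic_sdiff_Iic, measureReal_sdiff (Set.Iic_subset_Iic.2 hab.le) measurableSet_Iic]
    have hmap : ∀ i u, ((μ i).map (X i)).real (Set.Iic u) = (μ i).real {ω | X i ω ≤ u} := by
      intro i u
      rw [measureReal_def, Measure.map_apply_of_aemeasurable (hX i) measurableSet_Iic]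
      rfl
    have hlim := (h b).sub (h a)
    rw [← hIoc ν inferInstance] at hlim
    rw [← NNReal.tendsto_coe]
    simp only [Measure.map_id]
    refine hlim.congr fun i => ?_
    rw [← hmap, ← hmap, ← hIoc _ (Measure.isProbabilityMeasure_map (hX i))]
    rfl

lemma gumbelMeasure_real_Iic (u : ℝ) :
    gumbelMeasure.real (Set.Iic u) = Real.exp (-Real.exp (-u)) := by
  have h : Tendsto gumbelCDF atBot (𝓝 0) := by
    change Tendsto (fun x : ℝ => Real.exp (-Real.exp (-x))) atBot (𝓝 0)
    exact Real.tendsto_exp_neg_atTop_nhds_zero.comp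
      (Real.tendsto_exp_atTop.comp tendsto_neg_atBot_atTop)
  rw [measureReal_def, gumbelMeasure, StieltjesFunction.measure_Iic _ h, sub_zero]
  exact ENNReal.toReal_ofReal (Real.exp_pos _).le

lemma tendsto_one_sub_erlangTail_pow_atTop (m n : ℕ) :
    Tendsto (fun t => (1 - erlangTail m t) ^ n) atTop (𝓝 1) := by
  have h := ((tendsto_erlangTail_atTop m).const_sub 1).pow n
  rwa [sub_zero, one_pow] at h

/-! ### The Poissonized completion time -/

section Poisson

variable {Ω : Type*} [MeasurableSpace Ω] {μ : Measure Ω} {n : ℕ}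
  {N : Fin n → ℝ≥0 → Ω → ℕ} (hN : IsIIDPoisson N μ)
include hN

lemma IsIIDPoisson.measurableSet_complete (m : ℕ) (t : ℝ≥0) :
    MeasurableSet {ω | ∀ i, m ≤ N i t ω} := by
  rw [Set.ofPred_forall]
  exact MeasurableSet.iInter fun i => measurableSet_le measurable_const ((hN.poisson i).measurable t)

lemma IsIIDPoisson.measureReal_le (m : ℕ) (i : Fin n) (t : ℝ≥0) :
    μ.real {ω | m ≤ N i t ω} = 1 - erlangTail m t := by
  have h := ((hN.poisson i).law 0 t bot_le).measure_eq (p := fun k => m ≤ k) .of_discrete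
  rw [tsub_zero, one_mul] at h
  rw [← poissonMeasure_real_Ici, measureReal_def, measureReal_def]
  change _ = ((poissonMeasure t) {k | m ≤ k}).toReal
  rw [← h]
  congr 1
  refine measure_congr ?_
  filter_upwards [(hN.poisson i).zero] with ω hω
  change (m ≤ N i t ω) = (m ≤ N i t ω - N i 0 ω)
  rw [hω, Nat.sub_zero]

lemma IsIIDPoisson.measureReal_complete (m : ℕ) (t : ℝ≥0) :
    μ.real {ω | ∀ i, m ≤ N i t ω} = (1 - erlangTail m t) ^ n := by
  have hind : iIndepFun (fun i => (fun f : ℝ≥0 → ℕ => f t) ∘ fun ω s => N i s ω) μ :=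
    hN.indep.comp (fun _ f => f t) fun _ => measurable_pi_apply t
  have h := hind.measure_inter_preimage_eq_mul Finset.univ (sets := fun _ => Set.Ici m)
    fun _ _ => measurableSet_Ici
  have hset : {ω | ∀ i, m ≤ N i t ω} = ⋂ i ∈ Finset.univ,
      ((fun f : ℝ≥0 → ℕ => f t) ∘ fun ω s => N i s ω) ⁻¹' Set.Ici m := by
    ext ω; simp
  rw [hset, measureReal_def, h, ENNReal.toReal_prod]
  have : ∀ i : Fin n, (μ (((fun f : ℝ≥0 → ℕ => f t) ∘ fun ω s => N i s ω) ⁻¹' Set.Ici m)).toReal =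
      1 - erlangTail m t := fun i => hN.measureReal_le m i t
  simp [this]

variable [IsProbabilityMeasure μ]

lemma IsIIDPoisson.ae_exists_complete (m : ℕ) : ∀ᵐ ω ∂μ, ∃ t, ∀ i, m ≤ N i t ω := by
  rw [ae_iff, ← measureReal_eq_zero_iff]
  refine le_antisymm ?_ measureReal_nonneg
  have hlim : Tendsto (fun t : ℝ => 1 - (1 - erlangTail m t) ^ n) atTop (𝓝 0) := by
    simpa using (tendsto_one_sub_erlangTail_pow_atTop m n).const_sub 1
  refine ge_of_tendsto hlim ?_
  filter_upwards [eventually_ge_atTop 0] with t ht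
  have h := hN.measureReal_complete m ⟨t, ht⟩
  have hc := probReal_compl_eq_one_sub (μ := μ) (hN.measurableSet_complete m ⟨t, ht⟩)
  rw [h] at hc
  change _ = 1 - (1 - erlangTail m t) ^ n at hc
  rw [← hc]
  exact measureReal_mono fun ω hω hω' => hω ⟨_, hω'⟩

/-- Right-continuous integer-valued paths are locally constant to the right, so the infimum is
attained; monotonicity gives the rest. Nonemptiness matters because `sInf ∅ = 0`. -/
lemma IsIIDPoisson.ae_completionTime_le_iff (m : ℕ) :
    ∀ᵐ ω ∂μ, ∀ t : ℝ≥0, poissonCompletionTime m N ω ≤ t ↔ ∀ i, m ≤ N i t ω := by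
  have hmono : ∀ᵐ ω ∂μ, ∀ i, Monotone fun t => N i t ω :=
    ae_all_iff.2 fun i => (hN.poisson i).mono
  have hright : ∀ᵐ ω ∂μ, ∀ i t, ContinuousWithinAt (fun u => N i u ω) (Set.Ici t) t :=
    ae_all_iff.2 fun i => (hN.poisson i).rightCont
  filter_upwards [hmono, hright, hN.ae_exists_complete m] with ω h1 h2 h3 t
  set S := {s : ℝ≥0 | ∀ i, m ≤ N i s ω} with hS
  have hne : S.Nonempty := h3
  have hbdd : BddBelow S := OrderBot.bddBelow S
  have hmem : sInf S ∈ S := by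
    intro i
    have hcl := mem_closure_iff_frequently.1 (csInf_mem_closure hne hbdd)
    have hev : ∀ᶠ u in 𝓝[Set.Ici (sInf S)] (sInf S), N i u ω = N i (sInf S) ω :=
      (h2 i (sInf S)).eventually ((isOpen_discrete {N i (sInf S) ω}).mem_nhds rfl)
    rw [eventually_nhdsWithin_iff] at hev
    obtain ⟨u, hu, hu'⟩ := (hcl.and_eventually hev).exists
    rw [← hu' (csInf_le hbdd hu)]
    exact hu i
  change ((sInf S : ℝ≥0) : ℝ) ≤ t ↔ t ∈ S
  rw [NNReal.coe_le_coe]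
  exact ⟨fun h i => (hmem i).trans (h1 i h), fun h => csInf_le hbdd h⟩

lemma IsIIDPoisson.completionTime_le_ae_eq (m : ℕ) {x : ℝ} (hx : 0 ≤ x) :
    {ω | poissonCompletionTime m N ω ≤ x} =ᵐ[μ] {ω | ∀ i, m ≤ N i ⟨x, hx⟩ ω} := by
  filter_upwards [hN.ae_completionTime_le_iff m] with ω hω
  exact propext (hω ⟨x, hx⟩)

lemma IsIIDPoisson.aemeasurable_completionTime (m : ℕ) :
    AEMeasurable (poissonCompletionTime m N) μ := by
  -- Sublevel sets agree with measurable ones only almost everywhere, since the path properties hold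
  -- only almost surely.
  have h : NullMeasurable (poissonCompletionTime m N) μ := by
    refine @measurable_of_Iic ℝ (NullMeasurableSpace Ω μ) _ _ _ _ _ _ _ _ fun x => ?_
    rcases le_or_gt 0 x with hx | hx
    · exact (hN.measurableSet_complete m ⟨x, hx⟩).nullMeasurableSet.congr
        (hN.completionTime_le_ae_eq m hx).symm
    · have : poissonCompletionTime m N ⁻¹' Set.Iic x = ∅ := by
        ext ω
        simp only [Set.mem_preimage, Set.mem_Iic, Set.mem_empty_iff_false, iff_false, not_le]
        exact hx.trans_le (NNReal.coe_nonneg _)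
      exact this ▸ (MeasurableSet.empty : NullMeasurableSet (∅ : Set Ω) μ)
  exact h.aemeasurable

lemma IsIIDPoisson.measureReal_completionTime_le (m : ℕ) {x : ℝ} (hx : 0 ≤ x) :
    μ.real {ω | poissonCompletionTime m N ω ≤ x} = (1 - erlangTail m x) ^ n := by
  exact (measureReal_congr (hN.completionTime_le_ae_eq m hx)).trans
    (hN.measureReal_complete m ⟨x, hx⟩)

end Poisson

/-! ### The completion time of uniform draws -/

section Draws

variable {Ω : Type*} {n : ℕ} {U : ℕ → Ω → Fin n}

/-- The event that the first `k` draws contain every type at least `m` times. -/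
def completeAt (m : ℕ) (U : ℕ → Ω → Fin n) (k : ℕ) : Set Ω :=
  {ω | ∀ j : Fin n, m ≤ ((Finset.range k).filter fun i => U i ω = j).card}

lemma completeAt_mono (m : ℕ) (U : ℕ → Ω → Fin n) : Monotone (completeAt m U) := by
  intro k k' hkk ω hω j
  exact (hω j).trans (Finset.card_le_card
    (Finset.filter_subset_filter _ (Finset.range_subset_range.2 hkk)))

lemma drawCompletionTime_le_iff {m : ℕ} {ω : Ω} (h : ∃ k, ω ∈ completeAt m U k) (k : ℕ) :
    drawCompletionTime m U ω ≤ k ↔ ω ∈ completeAt m U k :=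
  ⟨fun hk => completeAt_mono m U hk (Nat.sInf_mem h), fun hk => Nat.sInf_le hk⟩

lemma completeAt_eq_preimage (m : ℕ) (U : ℕ → Ω → Fin n) (k : ℕ) :
    completeAt m U k = (fun ω (i : Fin k) => U i ω) ⁻¹'
      ((Finset.univ.filter fun w : Fin k → Fin n =>
        ∀ j, m ≤ (Finset.univ.filter fun i => w i = j).card : Finset (Fin k → Fin n)) :
        Set (Fin k → Fin n)) := by
  ext ω
  have h : ∀ j, ((Finset.range k).filter fun i => U i ω = j).card =
      (Finset.univ.filter fun i : Fin k => U i ω = j).card := by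
    intro j
    rw [Finset.card_filter, Finset.card_filter, Finset.sum_range]
  change (∀ j : Fin n, m ≤ ((Finset.range k).filter fun i => U i ω = j).card) ↔ _
  simp only [h, Set.mem_preimage, Finset.mem_coe, Finset.mem_filter, Finset.mem_univ, true_and]

variable [MeasurableSpace Ω] {μ : Measure Ω} (hU : IsUniformDraws U μ)
include hU

lemma IsUniformDraws.measurableSet_completeAt (m k : ℕ) : MeasurableSet (completeAt m U k) := by
  rw [completeAt_eq_preimage]
  exact measurable_pi_lambda _ (fun i : Fin k => hU.measurable i) (Finset.measurableSet _)

lemma IsUniformDraws.measurable_drawCompletionTime (m : ℕ) :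
    Measurable (drawCompletionTime m U) := by
  refine measurable_of_Iic fun k => ?_
  -- If the collection is never completed, `sInf ∅ = 0` puts the outcome in every sublevel set.
  have : drawCompletionTime m U ⁻¹' Set.Iic k =
      completeAt m U k ∪ ⋂ k', (completeAt m U k')ᶜ := by
    ext ω
    by_cases h : ∃ k, ω ∈ completeAt m U k
    · have h' : ω ∉ ⋂ k', (completeAt m U k')ᶜ := by simpa using h
      simp only [Set.mem_union, h', or_false]
      exact drawCompletionTime_le_iff h k
    · have h' : ω ∈ ⋂ k', (completeAt m U k')ᶜ := by simpa using h
      simp only [Set.mem_union, h', or_true, iff_true]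
      have hempty : {k : ℕ | ∀ j : Fin n,
          m ≤ ((Finset.range k).filter fun i => U i ω = j).card} = ∅ :=
        Set.eq_empty_iff_forall_notMem.2 fun k hk => h ⟨k, hk⟩
      simp [drawCompletionTime, hempty]
  rw [this]
  exact (hU.measurableSet_completeAt m k).union
    (MeasurableSet.iInter fun k' => (hU.measurableSet_completeAt m k').compl)

lemma IsUniformDraws.measureReal_eq (k : ℕ) (j : Fin n) :
    μ.real (U k ⁻¹' {j}) = (n : ℝ)⁻¹ := by
  have h := (hU.law k).measure_eq (p := fun i => i = j) .of_discrete
  rw [measureReal_def]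
  change (μ {ω | U k ω = j}).toReal = _
  rw [h, uniformOn_univ]
  simp

variable [IsProbabilityMeasure μ]

lemma IsUniformDraws.measureReal_completeAt (m k : ℕ) :
    μ.real (completeAt m U k) = collectProb n m k := by
  have hW : Measurable fun ω (i : Fin k) => U i ω :=
    measurable_pi_lambda _ fun i : Fin k => hU.measurable i
  have hword : ∀ w : Fin k → Fin n,
      (μ.map fun ω (i : Fin k) => U i ω).real {w} = ((n : ℝ) ^ k)⁻¹ := by
    intro w
    have hind := (hU.indep.precomp (Fin.val_injective (n := k))).measure_inter_preimage_eq_mul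
      Finset.univ (sets := fun i => {w i}) fun _ _ => measurableSet_singleton _
    rw [map_measureReal_apply hW (measurableSet_singleton _)]
    have hset : (fun ω (i : Fin k) => U i ω) ⁻¹' {w} =
        ⋂ i ∈ (Finset.univ : Finset (Fin k)), U i ⁻¹' {w i} := by
      ext ω; simp [funext_iff]
    rw [hset, measureReal_def, hind, ENNReal.toReal_prod]
    simp only [← measureReal_def, hU.measureReal_eq]
    simp
  rw [completeAt_eq_preimage, ← map_measureReal_apply hW (Finset.measurableSet _)]
  have := Measure.isProbabilityMeasure_map (μ := μ) hW.aemeasurable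
  rw [← sum_measureReal_singleton]
  simp only [hword, collectProb, Finset.sum_const, nsmul_eq_mul, div_eq_mul_inv]

/-- Monotonicity is read off from the nested completion events rather than from the word count. -/
lemma IsUniformDraws.monotone_collectProb (m : ℕ) : Monotone (collectProb n m) := by
  intro k k' hkk
  rw [← hU.measureReal_completeAt, ← hU.measureReal_completeAt]
  exact measureReal_mono (completeAt_mono m U hkk)

lemma IsUniformDraws.collectProb_le_one (m k : ℕ) : collectProb n m k ≤ 1 := by
  rw [← hU.measureReal_completeAt]
  exact measureReal_le_one

lemma IsUniformDraws.le_collectProb_add (hn : n ≠ 0) (m : ℕ) {t : ℝ} (ht : 0 ≤ t) {k : ℕ} {d : ℝ}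
    (hd : 0 < d) (hk : n * t + d ≤ k + 1) :
    (1 - erlangTail m t) ^ n ≤ collectProb n m k + n * t / d ^ 2 :=
  poisson_average_le (hU.monotone_collectProb m) (fun k => by unfold collectProb; positivity)
    (hU.collectProb_le_one m) (by positivity) (hasSum_poisson_mul_collectProb hn m ⟨t, ht⟩) hd hk

lemma IsUniformDraws.collectProb_le_add (hn : n ≠ 0) (m : ℕ) {t : ℝ} (ht : 0 ≤ t) {k : ℕ} {d : ℝ}
    (hd : 0 < d) (hk : k ≤ n * t - d) :
    collectProb n m k ≤ (1 - erlangTail m t) ^ n + n * t / d ^ 2 :=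
  le_poisson_average (hU.monotone_collectProb m) (fun k => by unfold collectProb; positivity)
    (hU.collectProb_le_one m) (by positivity) (hasSum_poisson_mul_collectProb hn m ⟨t, ht⟩) hd hk

lemma IsUniformDraws.ae_exists_completeAt (hn : n ≠ 0) (m : ℕ) :
    ∀ᵐ ω ∂μ, ∃ k, ω ∈ completeAt m U k := by
  rw [ae_iff, ← measureReal_eq_zero_iff]
  set E := {ω | ¬ ∃ k, ω ∈ completeAt m U k}
  have hE : ∀ k, μ.real E ≤ 1 - collectProb n m k := by
    intro k
    rw [← hU.measureReal_completeAt, ← probReal_compl_eq_one_sub (hU.measurableSet_completeAt m k)]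
    exact measureReal_mono fun ω hω hω' => hω ⟨k, hω'⟩
  -- The Poisson comparison with window `d = k + 1 - n t`, letting `k → ∞`; afterwards `t → ∞`.
  have hE2 : ∀ t : ℝ, 0 ≤ t → μ.real E ≤ 1 - (1 - erlangTail m t) ^ n := by
    intro t ht
    have hk : Tendsto (fun k : ℕ => (k : ℝ) + 1 - n * t) atTop atTop :=
      tendsto_atTop_add_const_right _ _ (tendsto_atTop_add_const_right _ 1
        tendsto_natCast_atTop_atTop)
    have hlim : Tendsto (fun k : ℕ => 1 - (1 - erlangTail m t) ^ n +
        n * t / ((k : ℝ) + 1 - n * t) ^ 2) atTop (𝓝 (1 - (1 - erlangTail m t) ^ n + 0)) :=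
      tendsto_const_nhds.add (tendsto_const_nhds.div_atTop
        ((tendsto_pow_atTop two_ne_zero).comp hk))
    rw [add_zero] at hlim
    refine ge_of_tendsto hlim ?_
    filter_upwards [hk.eventually_gt_atTop 0] with k hpos
    have := hU.le_collectProb_add hn m ht hpos (by linarith : n * t + _ ≤ (k : ℝ) + 1)
    linarith [hE k]
  refine le_antisymm ?_ measureReal_nonneg
  have hlim : Tendsto (fun t : ℝ => 1 - (1 - erlangTail m t) ^ n) atTop (𝓝 0) := by
    simpa using (tendsto_one_sub_erlangTail_pow_atTop m n).const_sub 1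
  refine ge_of_tendsto hlim ?_
  filter_upwards [eventually_ge_atTop 0] with t ht using hE2 t ht

lemma IsUniformDraws.measureReal_drawCompletionTime_le (hn : n ≠ 0) (m : ℕ) {x : ℝ} (hx : 0 ≤ x) :
    μ.real {ω | (drawCompletionTime m U ω : ℝ) ≤ x} = collectProb n m ⌊x⌋₊ := by
  rw [← hU.measureReal_completeAt]
  refine measureReal_congr ?_
  filter_upwards [hU.ae_exists_completeAt hn m] with ω hω
  refine propext (Iff.trans ?_ (drawCompletionTime_le_iff hω ⌊x⌋₊))
  exact (Nat.le_floor_iff hx).symm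

end Draws

/-! ### The two Gumbel limits -/

variable {p : ℕ+ → ℕ} {b : ℕ+ → ℝ}

/-- Depoissonization: `collectProb` is squeezed between the Poissonized distribution functions at
slightly shifted times, so it has the same limit. -/
lemma IsCentering.tendsto_collectProb (h : IsCentering p b)
    {Ω : ℕ+ → Type*} [∀ n, MeasurableSpace (Ω n)] {μ : ∀ n, Measure (Ω n)}
    [∀ n, IsProbabilityMeasure (μ n)] {U : ∀ n : ℕ+, ℕ → Ω n → Fin n}
    (hU : ∀ n, IsUniformDraws (U n) (μ n)) (u : ℝ) :
    Tendsto (fun n : ℕ+ => collectProb n (p n + 1)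
      ⌊(n : ℝ) * (b n + recipHazard (p n + 1) (b n) * u)⌋₊) atTop
      (𝓝 (Real.exp (-Real.exp (-u)))) := by
  have hD := h.tendsto_excess
  have hcont : Continuous fun v : ℝ => Real.exp (-Real.exp (-v)) := by fun_prop
  have hvar : ∀ v e : ℝ, Tendsto (fun n : ℕ+ => (b n + recipHazard (p n + 1) (b n) * v) /
      (n * recipHazard (p n + 1) (b n) ^ 2) / e ^ 2) atTop (𝓝 0) := by
    intro v e
    simpa using (h.tendsto_variance_ratio v).div_const (e ^ 2)
  have hvar_eq : ∀ (n : ℕ+) (t e : ℝ), 0 < e → 0 < recipHazard (p n + 1) (b n) →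
      n * t / (n * recipHazard (p n + 1) (b n) * e) ^ 2 =
        t / (n * recipHazard (p n + 1) (b n) ^ 2) / e ^ 2 := by
    intro n t e he ha
    have hn0 : (0 : ℝ) < n := by exact_mod_cast n.pos
    field_simp
  refine tendsto_order.2 ⟨fun c hc => ?_, fun c hc => ?_⟩
  · obtain ⟨e, he, hce⟩ : ∃ e : ℝ, 0 < e ∧ c < Real.exp (-Real.exp (-(u - e))) := by
      have hlim : Tendsto (fun e : ℝ => Real.exp (-Real.exp (-(u - e)))) (𝓝[>] 0)
          (𝓝 (Real.exp (-Real.exp (-(u - 0))))) :=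
        (hcont.comp (continuous_const.sub continuous_id)).continuousWithinAt
      rw [sub_zero] at hlim
      exact (eventually_mem_nhdsWithin.and (hlim.eventually_const_lt hc)).exists
    have hlim := (h.tendsto_one_sub_erlangTail_pow (u - e)).sub (hvar (u - e) e)
    rw [sub_zero] at hlim
    filter_upwards [hlim.eventually_const_lt hce, eventually_recipHazard_pos hD,
      eventually_shift_pos hD (u - e)] with n hlt ha ht
    have hn0 : (0 : ℝ) < n := by exact_mod_cast n.pos
    have hfl := Nat.lt_floor_add_one ((n : ℝ) * (b n + recipHazard (p n + 1) (b n) * u))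
    -- At time `t = b + a (u - e)` the window `d = n a e` gives `n t + d = n (b + a u)`, which is
    -- below the floor plus one. The upper bound uses `u + e` symmetrically.
    have hle := (hU n).le_collectProb_add n.ne_zero (p n + 1) ht.le
      (k := ⌊(n : ℝ) * (b n + recipHazard (p n + 1) (b n) * u)⌋₊)
      (d := n * recipHazard (p n + 1) (b n) * e) (by positivity) (by linarith)
    rw [hvar_eq n _ e he ha] at hle
    linarith
  · obtain ⟨e, he, hce⟩ : ∃ e : ℝ, 0 < e ∧ Real.exp (-Real.exp (-(u + e))) < c := by
      have hlim : Tendsto (fun e : ℝ => Real.exp (-Real.exp (-(u + e)))) (𝓝[>] 0)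
          (𝓝 (Real.exp (-Real.exp (-(u + 0))))) :=
        (hcont.comp (continuous_const.add continuous_id)).continuousWithinAt
      rw [add_zero] at hlim
      exact (eventually_mem_nhdsWithin.and (hlim.eventually_lt_const hc)).exists
    have hlim := (h.tendsto_one_sub_erlangTail_pow (u + e)).add (hvar (u + e) e)
    rw [add_zero] at hlim
    filter_upwards [hlim.eventually_lt_const hce, eventually_recipHazard_pos hD,
      eventually_shift_pos hD (u + e), eventually_shift_pos hD u] with n hlt ha ht hu
    have hn0 : (0 : ℝ) < n := by exact_mod_cast n.pos
    have hfl := Nat.floor_le (mul_pos hn0 hu).le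
    have hle := (hU n).collectProb_le_add n.ne_zero (p n + 1) ht.le
      (k := ⌊(n : ℝ) * (b n + recipHazard (p n + 1) (b n) * u)⌋₊)
      (d := n * recipHazard (p n + 1) (b n) * e) (by positivity) (by linarith)
    rw [hvar_eq n _ e he ha] at hle
    linarith

theorem IsCentering.tendstoInDistribution_poisson (h : IsCentering p b)
    {Ω : ℕ+ → Type*} [∀ n, MeasurableSpace (Ω n)] {μ : ∀ n, Measure (Ω n)}
    [∀ n, IsProbabilityMeasure (μ n)] {N : ∀ n : ℕ+, Fin n → ℝ≥0 → Ω n → ℕ}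
    (hN : ∀ n, IsIIDPoisson (N n) (μ n)) :
    TendstoInDistribution
      (fun n ω => (poissonCompletionTime (p n + 1) (N n) ω - b n) / recipHazard (p n + 1) (b n))
      atTop (id : ℝ → ℝ) μ gumbelMeasure := by
  refine tendstoInDistribution_of_tendsto_cdf
    (fun n => (((hN n).aemeasurable_completionTime _).sub_const _).div_const _) fun u => ?_
  rw [gumbelMeasure_real_Iic]
  refine (h.tendsto_one_sub_erlangTail_pow u).congr' ?_
  filter_upwards [eventually_recipHazard_pos h.tendsto_excess,
    eventually_shift_pos h.tendsto_excess u] with n ha ht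
  rw [← (hN n).measureReal_completionTime_le _ ht.le]
  congr 1
  ext ω
  simp only [Set.mem_ofPred_eq, div_le_iff₀ ha]
  constructor <;> intro _ <;> linarith

theorem IsCentering.tendstoInDistribution_draws (h : IsCentering p b)
    {Ω : ℕ+ → Type*} [∀ n, MeasurableSpace (Ω n)] {μ : ∀ n, Measure (Ω n)}
    [∀ n, IsProbabilityMeasure (μ n)] {U : ∀ n : ℕ+, ℕ → Ω n → Fin n}
    (hU : ∀ n, IsUniformDraws (U n) (μ n)) :
    TendstoInDistribution
      (fun n ω => ((drawCompletionTime (p n + 1) (U n) ω : ℝ) - (n : ℝ) * b n) /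
        ((n : ℝ) * recipHazard (p n + 1) (b n)))
      atTop (id : ℝ → ℝ) μ gumbelMeasure := by
  refine tendstoInDistribution_of_tendsto_cdf (fun n => ?_) fun u => ?_
  · exact (((measurable_from_top.comp
      ((hU n).measurable_drawCompletionTime (p n + 1))).sub_const _).div_const _).aemeasurable
  rw [gumbelMeasure_real_Iic]
  refine (h.tendsto_collectProb hU u).congr' ?_
  filter_upwards [eventually_recipHazard_pos h.tendsto_excess,
    eventually_shift_pos h.tendsto_excess u] with n ha ht
  have hn0 : (0 : ℝ) < n := by exact_mod_cast n.pos
  rw [← (hU n).measureReal_drawCompletionTime_le n.ne_zero _ (mul_pos hn0 ht).le]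
  congr 1
  ext ω
  simp only [Set.mem_ofPred_eq, div_le_iff₀ (mul_pos hn0 ha)]
  constructor <;> intro _ <;> linarith

end DixieCup

theorem mainTheorem2 (m : ℕ+ → ℕ) (hm : ∀ n, 1 ≤ m n) :
    (∀ᶠ n : ℕ+ in atTop,
      ∃! x : ℝ, 0 ≤ x ∧ (n : ℝ) * DixieCup.erlangTail (m n) x = 1) ∧
    ∀ b : ℕ+ → ℝ,
      (∀ᶠ n : ℕ+ in atTop,
        0 ≤ b n ∧ (n : ℝ) * DixieCup.erlangTail (m n) (b n) = 1) →
      (∀ (Ω : ℕ+ → Type*) [∀ n, MeasurableSpace (Ω n)] (μ : ∀ n, Measure (Ω n))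
          [∀ n, IsProbabilityMeasure (μ n)] (N : ∀ n : ℕ+, Fin n → ℝ≥0 → Ω n → ℕ),
          (∀ n, DixieCup.IsIIDPoisson (N n) (μ n)) →
          TendstoInDistribution
            (fun n ω => (DixieCup.poissonCompletionTime (m n) (N n) ω - b n) /
              DixieCup.recipHazard (m n) (b n))
            atTop (id : ℝ → ℝ) μ DixieCup.gumbelMeasure) ∧
      (∀ (Ω : ℕ+ → Type*) [∀ n, MeasurableSpace (Ω n)] (μ : ∀ n, Measure (Ω n))
          [∀ n, IsProbabilityMeasure (μ n)] (U : ∀ n : ℕ+, ℕ → Ω n → Fin n),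
          (∀ n, DixieCup.IsUniformDraws (U n) (μ n)) →
          TendstoInDistribution
            (fun n ω => ((DixieCup.drawCompletionTime (m n) (U n) ω : ℝ) - (n : ℝ) * b n) /
              ((n : ℝ) * DixieCup.recipHazard (m n) (b n)))
            atTop (id : ℝ → ℝ) μ DixieCup.gumbelMeasure) := by
  refine ⟨Eventually.of_forall fun n =>
    DixieCup.existsUnique_mul_erlangTail_eq_one (by exact_mod_cast n.pos) (hm n), ?_⟩
  -- Writing `m = p + 1` removes the truncated subtraction in `erlangDensity`.
  obtain ⟨p, rfl⟩ : ∃ p : ℕ+ → ℕ, m = fun n => p n + 1 :=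
    ⟨fun n => m n - 1, funext fun n => (Nat.sub_add_cancel (hm n)).symm⟩
  intro b hb
  have h : DixieCup.IsCentering p b := hb
  exact ⟨fun Ω _ μ _ N hN => h.tendstoInDistribution_poisson hN,
    fun Ω _ μ _ U hU => h.tendstoInDistribution_draws hU⟩
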